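/- For a real $n\times n$ matrix $A$ let $\|A\|_\infty=\max_{1\le i\le n}\sum_{j=1}^n|A_{ij}|$ denote the maximum absolute row sum, and call $A$ diagonally balanced if $|A_{ii}|=\sum_{j\neq i}|A_{ij}|$ for every $i$. Let $n\ge 3$, and let $J$ be a real symmetric $n\times n$ matrix with positive diagonal entries whose off-diagonal entries satisfy $m\ge J_{ij}\ge \ell>0$ for all $i\ne j$. If $J$ is diagonally balanced, then its adjugate $J^\star$ satisfies \[ \frac{\|J^\star\|_\infty}{\prod_{i=1}^n J_{ii}}\;\le\;\frac{3n-4}{2\ell(n-2)(n-1)}\,e^{-\ell^2/(4m^2)} . \] -/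

import Mathlib

open scoped Matrix

-- The norm on matrices is the maximum absolute row sum, i.e. the operator norm induced by
-- the sup norm on vectors.
attribute [local instance] Matrix.linftyOpNormedAddCommGroup

/-- The diagonal dominance `Δ_i(J) = |J_ii| - ∑_{j ≠ i} |J_ij|`. -/
def diagDominance {n : ℕ} (J : Matrix (Fin n) (Fin n) ℝ) (i : Fin n) : ℝ :=
  |J i i| - ∑ j ∈ Finset.univ.erase i, |J i j|

/-- `J` is diagonally balanced if `Δ_i(J) = 0` for all `i`. -/
def IsDiagBalanced {n : ℕ} (J : Matrix (Fin n) (Fin n) ℝ) : Prop :=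
  ∀ i, diagDominance J i = 0

/-!
The adjugate is `J.det • J⁻¹`, so the bound splits into a bound on `J.det / ∏ i, J i i` and a bound
on the absolute row sums of `J⁻¹`. Both start from the identity
`zᵀ J y = ½ ∑_{j ≠ k} J j k (z j + z k) (y j + y k)` (`sum_mul_mulVec_of_balanced`), which holds
because the diagonal entries are the off-diagonal row sums.

*Determinant* (`det_div_prod_diag_le_exp`). Scaling `J` on both sides by the diagonal matrix with
entries `1 / √(J i i)` gives a matrix `C` with unit diagonal and, by the identity, with eigenvalues
`λ` in `[0, 2]`. There `λ ≤ exp ((λ - 1) - (λ - 1) ^ 2 / 4)`. The terms `λ - 1` sum to zero, and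
the terms `(λ - 1) ^ 2` sum to the squared Frobenius norm of the off-diagonal part of `C`, which is
at least `ℓ ^ 2 / m ^ 2`.

*Inverse* (`sum_abs_le_of_mulVec_eq_single`). Let `S = (n - 2) I + 1 1ᵀ`, which is the balanced
matrix with off-diagonal entries `1`, and let `J y = e_i`. The claim is `‖y‖₁ ≤ ‖S⁻¹‖_∞ / ℓ`.
Consider the closed convex cone of all `z` with `(z j + z k) (y j + y k) ≥ 0` for `j ≠ k`. By the
identity `zᵀ J y ≥ ℓ zᵀ S y` for `z` in this cone. Let `σ = sign y` and let `z` minimize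
`zᵀ S z - 2 σᵀ z` over the cone. Since `z + t y` stays in the cone for `t ≥ 0`, the first order
condition gives `‖y‖₁ = σᵀ y ≤ zᵀ S y ≤ zᵀ J y / ℓ = z i / ℓ`, so it remains to bound `z i`.

The vector `z + t u` stays in the cone for small `t` of either sign as soon as `z j + z k = 0`
forces `u j + u k = 0`; hence `uᵀ S z = σᵀ u` for all such `u`. Two choices of `u` suffice
(`le_of_stationary`): the odd indicator of the level `{k | |z k| = |z i|}`, and the
vector `levelMean z` which on each level `{k | |z k| = v}` is `± w / s`, where
`w = #{z k = v} - #{z k = -v}` and `s` is the size of the level. The latter is the orthogonal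
projection of the all-ones vector to the odd functions of `z`. These two equations and the
Cauchy-Schwarz inequality reduce the bound to `extremal_inequality`, in which equality occurs
when `z` has no zero entry, no level contains entries of both signs, the level of `z i` is `{i}`,
`z i > 0`, and `σ` is `1` at `i` and `-1` elsewhere.
-/

/-! ### Bilinear forms of balanced matrices -/

theorem sum_mul_mulVec_eq_sum_sum {n : ℕ} {J : Matrix (Fin n) (Fin n) ℝ}
    (hJ : ∀ i, J i i = ∑ j ∈ Finset.univ.erase i, J i j) (z y : Fin n → ℝ) :
    ∑ j, z j * (J *ᵥ y) j =
      ∑ j, ∑ k ∈ Finset.univ.erase j, J j k * (z j * (y j + y k)) := by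
  refine Finset.sum_congr rfl fun j _ => ?_
  rw [Matrix.mulVec, dotProduct, ← Finset.add_sum_erase _ _ (Finset.mem_univ j), hJ j,
    Finset.sum_mul, ← Finset.sum_add_distrib, Finset.mul_sum]
  exact Finset.sum_congr rfl fun k _ => by ring

theorem sum_mul_mulVec_of_balanced {n : ℕ} {J : Matrix (Fin n) (Fin n) ℝ} (hsymm : J.IsSymm)
    (hJ : ∀ i, J i i = ∑ j ∈ Finset.univ.erase i, J i j) (z y : Fin n → ℝ) :
    ∑ j, z j * (J *ᵥ y) j =
      (1 / 2) * ∑ j, ∑ k ∈ Finset.univ.erase j, J j k * ((z j + z k) * (y j + y k)) := by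
  have hconv : ∀ (f : Fin n → Fin n → ℝ), ∑ j, ∑ k ∈ Finset.univ.erase j, f j k =
      ∑ j, ∑ k, if j = k then 0 else f j k := by
    intro f
    refine Finset.sum_congr rfl fun j _ => ?_
    rw [← Finset.add_sum_erase _ _ (Finset.mem_univ j)]
    simp only [if_true, zero_add]
    exact Finset.sum_congr rfl fun k hk => by rw [if_neg (Finset.ne_of_mem_erase hk).symm]
  have h1 := sum_mul_mulVec_eq_sum_sum hJ z y
  have h2 : ∑ j, ∑ k ∈ Finset.univ.erase j, J j k * (z j * (y j + y k)) =
      ∑ j, ∑ k ∈ Finset.univ.erase j, J j k * (z k * (y j + y k)) := by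
    rw [hconv, hconv, Finset.sum_comm]
    refine Finset.sum_congr rfl fun j _ => Finset.sum_congr rfl fun k _ => ?_
    rw [hsymm.apply j k, add_comm (y k)]
    simp only [eq_comm]
  have h3 : ∑ j, ∑ k ∈ Finset.univ.erase j, J j k * ((z j + z k) * (y j + y k)) =
      ∑ j, ∑ k ∈ Finset.univ.erase j, J j k * (z j * (y j + y k)) +
      ∑ j, ∑ k ∈ Finset.univ.erase j, J j k * (z k * (y j + y k)) := by
    simp only [← Finset.sum_add_distrib]
    refine Finset.sum_congr rfl fun j _ => Finset.sum_congr rfl fun k _ => ?_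
    ring
  rw [h3, ← h2, h1]
  ring

/-- The bilinear form of the balanced matrix `(n - 2) I + 1 1ᵀ`, whose off-diagonal entries are `1`. -/
theorem sum_sum_erase_add_mul_add {n : ℕ} (z y : Fin n → ℝ) :
    (1 / 2) * ∑ j, ∑ k ∈ Finset.univ.erase j, ((z j + z k) * (y j + y k)) =
      ((n : ℝ) - 2) * ∑ j, z j * y j + (∑ j, z j) * ∑ j, y j := by
  have h : ∀ j, ∑ k ∈ Finset.univ.erase j, ((z j + z k) * (y j + y k)) =
      n * (z j * y j) + z j * ∑ k, y k + (∑ k, z k) * y j + ∑ k, z k * y k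
        - 4 * (z j * y j) := by
    intro j
    have h0 := Finset.add_sum_erase Finset.univ (fun k => (z j + z k) * (y j + y k))
      (Finset.mem_univ j)
    have h1 : ∑ k, ((z j + z k) * (y j + y k)) =
      n * (z j * y j) + z j * ∑ k, y k + (∑ k, z k) * y j + ∑ k, z k * y k := by
      simp only [add_mul, mul_add, Finset.sum_add_distrib, ← Finset.mul_sum, ← Finset.sum_mul,
        Finset.sum_const, Finset.card_univ, Fintype.card_fin, nsmul_eq_mul]
      ring
    rw [h1] at h0
    linarith
  simp only [h, Finset.sum_add_distrib, Finset.sum_sub_distrib, ← Finset.mul_sum,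
    ← Finset.sum_mul, Finset.sum_const, Finset.card_univ, Fintype.card_fin, nsmul_eq_mul]
  ring

/-- The bilinear form of `J` dominates `ℓ` times that of `(n - 2) I + 1 1ᵀ` on pairs `z`, `y` for which
`z j + z k` and `y j + y k` never have opposite signs. -/
theorem le_sum_mul_mulVec_of_balanced {n : ℕ} {J : Matrix (Fin n) (Fin n) ℝ} (hsymm : J.IsSymm)
    (hJ : ∀ i, J i i = ∑ j ∈ Finset.univ.erase i, J i j) {ℓ : ℝ}
    (hlower : ∀ i j, i ≠ j → ℓ ≤ J i j) {z y : Fin n → ℝ}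
    (hzy : ∀ j k, j ≠ k → 0 ≤ (z j + z k) * (y j + y k)) :
    ℓ * (((n : ℝ) - 2) * ∑ j, z j * y j + (∑ j, z j) * ∑ j, y j) ≤
      ∑ j, z j * (J *ᵥ y) j := by
  rw [sum_mul_mulVec_of_balanced hsymm hJ, ← sum_sum_erase_add_mul_add, mul_left_comm]
  refine mul_le_mul_of_nonneg_left ?_ (by norm_num)
  simp only [Finset.mul_sum]
  refine Finset.sum_le_sum fun j _ => Finset.sum_le_sum fun k hk => ?_
  have hjk := (Finset.ne_of_mem_erase hk).symm
  exact mul_le_mul_of_nonneg_right (hlower j k hjk) (hzy j k hjk)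

theorem posDef_of_balanced {n : ℕ} (hn : 3 ≤ n) {J : Matrix (Fin n) (Fin n) ℝ}
    (hsymm : J.IsSymm) (hJ : ∀ i, J i i = ∑ j ∈ Finset.univ.erase i, J i j) {ℓ : ℝ}
    (hℓ : 0 < ℓ) (hlower : ∀ i j, i ≠ j → ℓ ≤ J i j) : J.PosDef := by
  have hn' : (3 : ℝ) ≤ n := by exact_mod_cast hn
  refine Matrix.PosDef.of_dotProduct_mulVec_pos
    (by rw [Matrix.IsHermitian, Matrix.conjTranspose_eq_transpose_of_trivial]; exact hsymm)
    fun {x} hx => ?_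
  have h := le_sum_mul_mulVec_of_balanced hsymm hJ hlower (z := x) (y := x)
    fun j k _ => mul_self_nonneg _
  obtain ⟨i, hi⟩ := Function.ne_iff.mp hx
  have hpos : 0 < ∑ j, x j * x j :=
    Finset.sum_pos' (fun j _ => mul_self_nonneg _) ⟨i, Finset.mem_univ i, mul_self_pos.mpr hi⟩
  have : 0 < ((n : ℝ) - 2) * ∑ j, x j * x j + (∑ j, x j) * ∑ j, x j :=
    add_pos_of_pos_of_nonneg (mul_pos (by linarith) hpos) (mul_self_nonneg _)
  simpa [dotProduct] using (mul_pos hℓ this).trans_le h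

/-- If `D` is the diagonal part of `J` then `2 D - J` is positive semidefinite: its quadratic form is
`½ ∑_{j ≠ k} J j k (x j - x k) ^ 2`. -/
theorem sum_mul_mulVec_le_two_mul_diag {n : ℕ} {J : Matrix (Fin n) (Fin n) ℝ} (hsymm : J.IsSymm)
    (hJ : ∀ i, J i i = ∑ j ∈ Finset.univ.erase i, J i j)
    (hnonneg : ∀ i j, i ≠ j → 0 ≤ J i j) (x : Fin n → ℝ) :
    ∑ j, x j * (J *ᵥ x) j ≤ 2 * ∑ j, J j j * x j ^ 2 := by
  have hplus := sum_mul_mulVec_of_balanced hsymm hJ x x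
  have hsq : ∑ j, J j j * x j ^ 2 = ∑ j, ∑ k ∈ Finset.univ.erase j, J j k * x j ^ 2 := by
    refine Finset.sum_congr rfl fun j _ => ?_
    rw [hJ j, Finset.sum_mul]
  have hx := sum_mul_mulVec_eq_sum_sum hJ x x
  -- `4 x_j (x_j + x_k) - (x_j + x_k) ^ 2 - 4 x_j ^ 2 = - (x_j - x_k) ^ 2`
  have key : ∑ j, ∑ k ∈ Finset.univ.erase j, J j k * (x j * (x j + x k)) * 4 ≤
      ∑ j, ∑ k ∈ Finset.univ.erase j,
        (J j k * ((x j + x k) * (x j + x k)) + 4 * (J j k * x j ^ 2)) := by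
    refine Finset.sum_le_sum fun j _ => Finset.sum_le_sum fun k hk => ?_
    have := mul_nonneg (hnonneg j k (Finset.ne_of_mem_erase hk).symm) (sq_nonneg (x j - x k))
    linarith
  simp only [Finset.sum_add_distrib, ← Finset.sum_mul, ← Finset.mul_sum] at key hsq hx hplus ⊢
  linarith

/-! ### The determinant -/

/-- `log (1 + t) ≤ t - t ^ 2 / 4` for `|t| ≤ 1`, written multiplicatively with `x = 1 + t`. -/
theorem Real.le_exp_sub_one_sub_sq {x : ℝ} (h0 : 0 ≤ x) (h2 : x ≤ 2) :
    x ≤ Real.exp ((x - 1) - (x - 1) ^ 2 / 4) := by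
  rcases le_total 1 x with h | h
  · have := Real.quadratic_le_exp_of_nonneg (x := (x - 1) - (x - 1) ^ 2 / 4) (by nlinarith)
    refine le_trans ?_ this
    obtain ⟨d, rfl⟩ : ∃ d, x = 1 + d := ⟨x - 1, by ring⟩
    -- with `x = 1 + d` the quadratic bound exceeds `x` by `d ^ 2 * (2 * (1 - d / 4) ^ 2 - 1) / 4`
    have : 1 ≤ 2 * (1 - d / 4) ^ 2 := by nlinarith
    nlinarith [mul_nonneg (sq_nonneg d) (sub_nonneg.mpr this)]
  · rcases h0.eq_or_lt with rfl | h0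
    · positivity
    have hs : |1 - x| < 1 := by rw [abs_of_nonneg (by linarith)]; linarith
    -- the first two terms of the series of `-log (1 - s)` at `s = 1 - x`
    have := sum_le_hasSum (Finset.range 2) (fun k _ => by
      have : 0 ≤ 1 - x := by linarith
      positivity) (Real.hasSum_pow_div_log_of_abs_lt_one hs)
    rw [← Real.log_le_iff_le_exp h0]
    norm_num [Finset.sum_range_succ] at this
    nlinarith [sq_nonneg (x - 1)]

theorem Matrix.IsHermitian.trace_mul_self_eq_sum {n : Type*} [Fintype n] [DecidableEq n]
    {A : Matrix n n ℝ} (hA : A.IsHermitian) :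
    (A * A).trace = ∑ i, hA.eigenvalues i ^ 2 := by
  have h := hA.spectral_theorem
  rw [congrArg₂ (· * ·) h h, ← map_mul, Unitary.conjStarAlgAut_apply, Matrix.trace_mul_cycle]
  simp [Matrix.trace_diagonal, sq]

/-- The unit diagonal makes the eigenvalues average to `1`, so the linear terms of the exponents in
`Real.le_exp_sub_one_sub_sq` cancel in the product over the eigenvalues. -/
theorem det_le_exp_of_eigenvalues_mem {n : ℕ} {C : Matrix (Fin n) (Fin n) ℝ}
    (hC : C.IsHermitian) (h0 : ∀ i, 0 ≤ hC.eigenvalues i) (h2 : ∀ i, hC.eigenvalues i ≤ 2)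
    (hdiag : ∀ i, C i i = 1) :
    C.det ≤ Real.exp (-(∑ i, ∑ j ∈ Finset.univ.erase i, C i j ^ 2) / 4) := by
  have htr : ∑ i, hC.eigenvalues i = n := by
    have := hC.trace_eq_sum_eigenvalues
    simpa [Matrix.trace, hdiag] using this.symm
  have htr2 : ∑ i, hC.eigenvalues i ^ 2 = n + ∑ i, ∑ j ∈ Finset.univ.erase i, C i j ^ 2 := by
    have hrow : ∀ i, (C * C) i i = 1 + ∑ j ∈ Finset.univ.erase i, C i j ^ 2 := by
      intro i
      rw [Matrix.mul_apply, ← Finset.add_sum_erase _ _ (Finset.mem_univ i), hdiag, mul_one]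
      refine congrArg _ (Finset.sum_congr rfl fun j _ => ?_)
      have : C j i = C i j := by simpa using hC.apply i j
      rw [this, sq]
    rw [← hC.trace_mul_self_eq_sum, Matrix.trace]
    simp [hrow, Finset.sum_add_distrib]
  rw [hC.det_eq_prod_eigenvalues]
  refine (Finset.prod_le_prod (fun i _ => h0 i)
    fun i _ => Real.le_exp_sub_one_sub_sq (h0 i) (h2 i)).trans_eq ?_
  rw [← Real.exp_sum]
  congr 1
  have : ∀ i, hC.eigenvalues i - 1 - (hC.eigenvalues i - 1) ^ 2 / 4 =
      (3 / 2) * hC.eigenvalues i - 5 / 4 - hC.eigenvalues i ^ 2 / 4 := fun i => by ring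
  simp only [this, Finset.sum_sub_distrib, ← Finset.mul_sum, ← Finset.sum_div, htr, htr2,
    Finset.sum_const, Finset.card_univ, Fintype.card_fin, nsmul_eq_mul]
  ring

theorem det_div_prod_diag_le_exp {n : ℕ} (hn : 3 ≤ n) {ℓ m : ℝ} (hℓ : 0 < ℓ)
    {J : Matrix (Fin n) (Fin n) ℝ} (hsymm : J.IsSymm)
    (hlower : ∀ i j, i ≠ j → ℓ ≤ J i j) (hupper : ∀ i j, i ≠ j → J i j ≤ m)
    (hdiag : ∀ i, 0 < J i i) (hJ : ∀ i, J i i = ∑ j ∈ Finset.univ.erase i, J i j) :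
    J.det / ∏ i, J i i ≤ Real.exp (-ℓ ^ 2 / (4 * m ^ 2)) := by
  have hn' : (3 : ℝ) ≤ n := by exact_mod_cast hn
  set d : Fin n → ℝ := fun i => (√(J i i))⁻¹ with hd
  have hd0 : ∀ i, 0 < d i := fun i => inv_pos.mpr (Real.sqrt_pos.mpr (hdiag i))
  have hd2 : ∀ i, d i ^ 2 = (J i i)⁻¹ := fun i => by
    rw [hd, inv_pow, Real.sq_sqrt (hdiag i).le]
  set C := Matrix.diagonal d * J * Matrix.diagonal d with hC_def
  have hCapp : ∀ i j, C i j = d i * J i j * d j := fun i j => by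
    rw [hC_def, Matrix.mul_diagonal, Matrix.diagonal_mul]
  have hC : C.IsHermitian := by
    ext i j
    rw [Matrix.conjTranspose_apply, hCapp, hCapp, hsymm.apply i j, star_trivial]
    ring
  have hCdet : C.det = J.det / ∏ i, J i i := by
    rw [hC_def, Matrix.det_mul, Matrix.det_mul, Matrix.det_diagonal, div_eq_mul_inv,
      ← Finset.prod_inv_distrib]
    simp only [← hd2, Finset.prod_pow]
    ring
  have hquad : ∀ x : Fin n → ℝ, x ⬝ᵥ (C *ᵥ x) =
      ∑ j, (d j * x j) * (J *ᵥ fun k => d k * x k) j := by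
    intro x
    simp only [dotProduct, Matrix.mulVec, Finset.mul_sum, hCapp]
    exact Finset.sum_congr rfl fun j _ => Finset.sum_congr rfl fun k _ => by ring
  have hpsd : C.PosSemidef := by
    refine Matrix.PosSemidef.of_dotProduct_mulVec_nonneg hC fun x => ?_
    rw [star_trivial, hquad]
    have := (posDef_of_balanced hn hsymm hJ hℓ hlower).posSemidef.dotProduct_mulVec_nonneg
      fun k => d k * x k
    rwa [star_trivial] at this
  have hle2 : ∀ i, hC.eigenvalues i ≤ 2 := by
    intro i
    rw [hC.eigenvalues_eq i]
    set x : Fin n → ℝ := ⇑(hC.eigenvectorBasis i) with hx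
    have hnorm : ∑ j, x j ^ 2 = 1 := by
      have h1 := hC.eigenvectorBasis.norm_eq_one i
      have h2 := EuclideanSpace.real_norm_sq_eq (hC.eigenvectorBasis i)
      rw [h1] at h2
      linarith
    have h1 := sum_mul_mulVec_le_two_mul_diag hsymm hJ
      (fun i j hij => hℓ.le.trans (hlower i j hij)) fun k => d k * x k
    have h2 : ∀ j, J j j * (d j * x j) ^ 2 = x j ^ 2 := fun j => by
      rw [mul_pow, hd2, mul_inv_cancel_left₀ (hdiag j).ne']
    rw [← hquad] at h1
    simp only [h2, hnorm] at h1
    simpa using h1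
  rw [← hCdet]
  refine (det_le_exp_of_eigenvalues_mem hC hpsd.eigenvalues_nonneg hle2 fun i => ?_).trans
    (Real.exp_le_exp.mpr ?_)
  · rw [hCapp]
    have := hd2 i
    have h' := mul_inv_cancel₀ (hdiag i).ne'
    rw [← this] at h'
    linear_combination h'
  have hℓm : ℓ ≤ m := by
    have h01 : (⟨0, by omega⟩ : Fin n) ≠ ⟨1, by omega⟩ := by simp
    exact (hlower _ _ h01).trans (hupper _ _ h01)
  have hm : 0 < m := hℓ.trans_le hℓm
  have hJle : ∀ i, J i i ≤ (n - 1) * m := by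
    intro i
    rw [hJ i]
    refine (Finset.sum_le_card_nsmul _ _ m fun j hj =>
      hupper i j (Finset.ne_of_mem_erase hj).symm).trans_eq ?_
    rw [Finset.card_erase_of_mem (Finset.mem_univ i), Finset.card_univ, Fintype.card_fin,
      nsmul_eq_mul, Nat.cast_sub (by omega), Nat.cast_one]
  -- each scaled entry is at least `ℓ / ((n - 1) m)`, since `J i i ≤ (n - 1) m`
  have hentry : ∀ i j, i ≠ j → (ℓ / ((n - 1) * m)) ^ 2 ≤ C i j ^ 2 := by
    intro i j hij
    have hb : 0 < ((n : ℝ) - 1) * m := mul_pos (by linarith) hm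
    have h1 : ∀ k, (((n : ℝ) - 1) * m)⁻¹ ≤ d k ^ 2 := fun k => by
      rw [hd2]; exact inv_anti₀ (hdiag k) (hJle k)
    rw [hCapp, div_pow, mul_pow (d i * J i j), mul_pow (d i)]
    calc ℓ ^ 2 / (((n : ℝ) - 1) * m) ^ 2
        = (((n : ℝ) - 1) * m)⁻¹ * ℓ ^ 2 * (((n : ℝ) - 1) * m)⁻¹ := by field_simp
      _ ≤ d i ^ 2 * J i j ^ 2 * d j ^ 2 := by
        have h2 := h1 i
        have h3 := h1 j
        have h4 := hlower i j hij
        gcongr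
  have hsum : (n : ℝ) * (((n : ℝ) - 1) * (ℓ / ((n - 1) * m)) ^ 2) ≤
      ∑ i, ∑ j ∈ Finset.univ.erase i, C i j ^ 2 := by
    have : ∀ i, ((n : ℝ) - 1) * (ℓ / ((n - 1) * m)) ^ 2 ≤
        ∑ j ∈ Finset.univ.erase i, C i j ^ 2 := by
      intro i
      refine le_trans (le_of_eq ?_) (Finset.card_nsmul_le_sum _ _ _ fun j hj =>
        hentry i j (Finset.ne_of_mem_erase hj).symm)
      rw [Finset.card_erase_of_mem (Finset.mem_univ i), Finset.card_univ, Fintype.card_fin,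
        nsmul_eq_mul, Nat.cast_sub (by omega), Nat.cast_one]
    refine le_trans (le_of_eq ?_) (Finset.card_nsmul_le_sum _ _ _ fun i _ => this i)
    rw [Finset.card_univ, Fintype.card_fin, nsmul_eq_mul]
  have hfin : ℓ ^ 2 / m ^ 2 ≤ (n : ℝ) * (((n : ℝ) - 1) * (ℓ / ((n - 1) * m)) ^ 2) := by
    have hn1 : (0 : ℝ) < n - 1 := by linarith
    have : (n : ℝ) * (((n : ℝ) - 1) * (ℓ / ((n - 1) * m)) ^ 2) =
        (n / (n - 1)) * (ℓ ^ 2 / m ^ 2) := by field_simp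
    rw [this]
    refine le_mul_of_one_le_left (by positivity) ?_
    rw [one_le_div hn1]
    linarith
  have : -ℓ ^ 2 / (4 * m ^ 2) = -(ℓ ^ 2 / m ^ 2) / 4 := by field_simp
  rw [this]
  linarith

/-! ### Minimization over a cone -/

section variational

open Filter Topology

/-- First order condition for a minimizer `z` of `N ∑ z k ^ 2 + (∑ z k) ^ 2 - 2 ∑ σ k z k` over the
cone of vectors with `(z j + z k) (y j + y k) ≥ 0`: the derivative is nonnegative in every direction
`u` that stays in the cone for a short time. -/
theorem exists_variational_inequality {n : ℕ} {N : ℝ} (hN : 1 ≤ N) (y σ : Fin n → ℝ)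
    (hσ : ∀ k, |σ k| ≤ 1) :
    ∃ z : Fin n → ℝ, (∀ j k, j ≠ k → 0 ≤ (z j + z k) * (y j + y k)) ∧
      ∀ u : Fin n → ℝ,
        (∀ᶠ t in 𝓝[>] (0 : ℝ), ∀ j k, j ≠ k →
          0 ≤ (z j + t * u j + (z k + t * u k)) * (y j + y k)) →
        ∑ k, σ k * u k ≤ N * ∑ k, z k * u k + (∑ k, z k) * ∑ k, u k := by
  set K : Set (Fin n → ℝ) := {z | ∀ j k, j ≠ k → 0 ≤ (z j + z k) * (y j + y k)} with hK
  set f : (Fin n → ℝ) → ℝ :=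
    fun z => N * ∑ k, z k ^ 2 + (∑ k, z k) ^ 2 - 2 * ∑ k, σ k * z k with hf
  have hfc : Continuous f := by fun_prop
  have hKc : IsClosed K := by
    simp only [hK, Set.ofPred_forall]
    exact isClosed_iInter fun j => isClosed_iInter fun k => isClosed_iInter fun _ =>
      isClosed_le continuous_const (by fun_prop)
  have h0K : (0 : Fin n → ℝ) ∈ K := by intro j k _; simp
  obtain ⟨z, hz, hmin⟩ := ((isCompact_closedBall (0 : Fin n → ℝ) (n + 2)).inter_left
    hKc).exists_isMinOn ⟨0, h0K, by simp; positivity⟩ hfc.continuousOn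
  have hz0 : f z ≤ 0 := by
    have := hmin ⟨h0K, by simp; positivity⟩
    simpa [hf] using this
  -- outside the ball the functional is positive, so the minimum over the ball is global
  have hglob : ∀ x ∈ K, f z ≤ f x := by
    intro x hx
    by_cases hxb : x ∈ Metric.closedBall (0 : Fin n → ℝ) (n + 2)
    · exact hmin ⟨hx, hxb⟩
    refine hz0.trans ?_
    rw [mem_closedBall_zero_iff, pi_norm_le_iff_of_nonneg (by positivity)] at hxb
    push Not at hxb
    obtain ⟨k, hk⟩ := hxb
    rw [Real.norm_eq_abs] at hk
    have h1 : ∑ j, (x j ^ 2 - 2 * (σ j * x j)) ≤ f x := by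
      rw [Finset.sum_sub_distrib, ← Finset.mul_sum]
      have : 0 ≤ (N - 1) * ∑ j, x j ^ 2 :=
        mul_nonneg (by linarith) (Finset.sum_nonneg fun _ _ => sq_nonneg _)
      simp only [hf]
      nlinarith [sq_nonneg (∑ j, x j)]
    have h2 : ∀ j, (|x j| - 1) ^ 2 - 1 ≤ x j ^ 2 - 2 * (σ j * x j) := by
      intro j
      have : σ j * x j ≤ |x j| :=
        (le_abs_self _).trans ((abs_mul _ _).trans_le
          (mul_le_of_le_one_left (abs_nonneg _) (hσ j)))
      nlinarith [sq_abs (x j)]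
    have h3 : (|x k| - 1) ^ 2 ≤ ∑ j, (|x j| - 1) ^ 2 :=
      Finset.single_le_sum (f := fun j => (|x j| - 1) ^ 2) (fun _ _ => sq_nonneg _)
        (Finset.mem_univ k)
    have h4 : ∑ j, ((|x j| - 1) ^ 2 - 1) ≤ ∑ j, (x j ^ 2 - 2 * (σ j * x j)) :=
      Finset.sum_le_sum fun j _ => h2 j
    rw [Finset.sum_sub_distrib] at h4
    simp only [Finset.sum_const, Finset.card_univ, Fintype.card_fin, nsmul_eq_mul] at h4
    have : (0 : ℝ) ≤ n := n.cast_nonneg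
    nlinarith
  refine ⟨z, hz.1, fun u hu => ?_⟩
  set g := N * ∑ k, z k * u k + (∑ k, z k) * ∑ k, u k - ∑ k, σ k * u k with hg
  set q := N * ∑ k, u k ^ 2 + (∑ k, u k) ^ 2 with hq
  have hexp : ∀ t : ℝ, f (fun k => z k + t * u k) = f z + t * (2 * g + t * q) := by
    intro t
    have e1 : ∑ k, (z k + t * u k) ^ 2 =
        ∑ k, z k ^ 2 + 2 * t * ∑ k, z k * u k + t ^ 2 * ∑ k, u k ^ 2 := by
      simp only [Finset.mul_sum, ← Finset.sum_add_distrib]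
      exact Finset.sum_congr rfl fun k _ => by ring
    have e2 : ∑ k, σ k * (z k + t * u k) = ∑ k, σ k * z k + t * ∑ k, σ k * u k := by
      simp only [Finset.mul_sum, ← Finset.sum_add_distrib]
      exact Finset.sum_congr rfl fun k _ => by ring
    simp only [hf, e1, e2, Finset.sum_add_distrib, ← Finset.mul_sum, hg, hq]
    ring
  have hev : ∀ᶠ t in 𝓝[>] (0 : ℝ), 0 ≤ 2 * g + t * q := by
    filter_upwards [hu, self_mem_nhdsWithin] with t ht ht0
    have := hglob _ ht
    rw [hexp t] at this
    exact nonneg_of_mul_nonneg_right (by linarith) ht0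
  have hlim : Tendsto (fun t : ℝ => 2 * g + t * q) (𝓝[>] 0) (𝓝 (2 * g + 0 * q)) :=
    tendsto_nhdsWithin_of_tendsto_nhds
      (Continuous.tendsto (f := fun t : ℝ => 2 * g + t * q) (by fun_prop) 0)
  have := ge_of_tendsto hlim hev
  linarith

/-- A direction `u` is feasible if the sums `u j + u k` vanish wherever `z j + z k` do: where
`z j + z k ≠ 0`, either `y j + y k = 0` or the constraint is strict. -/
theorem eventually_feasible {n : ℕ} {y z u : Fin n → ℝ}
    (hz : ∀ j k, j ≠ k → 0 ≤ (z j + z k) * (y j + y k))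
    (hu : ∀ j k, z j + z k = 0 → u j + u k = 0) :
    ∀ᶠ t in 𝓝[>] (0 : ℝ), ∀ j k, j ≠ k →
      0 ≤ (z j + t * u j + (z k + t * u k)) * (y j + y k) := by
  refine eventually_all.mpr fun j => eventually_all.mpr fun k => ?_
  by_cases hjk : j = k
  · exact Eventually.of_forall fun t h => absurd hjk h
  rcases (hz j k hjk).eq_or_lt with h | h
  · refine Eventually.of_forall fun t _ => ?_
    rcases mul_eq_zero.mp h.symm with h' | h'
    · have h2 : z j + t * u j + (z k + t * u k) = 0 := by
        linear_combination h' + t * hu j k h'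
      simp [h2]
    · simp [h']
  · have hlim : Tendsto (fun t : ℝ => (z j + t * u j + (z k + t * u k)) * (y j + y k)) (𝓝 0)
        (𝓝 ((z j + 0 * u j + (z k + 0 * u k)) * (y j + y k))) :=
      Continuous.tendsto (by fun_prop) 0
    simp only [zero_mul, add_zero] at hlim
    exact (tendsto_nhdsWithin_of_tendsto_nhds hlim).eventually (lt_mem_nhds h) |>.mono
      fun t ht _ => ht.le

end variational

/-! ### Levels of absolute value -/

/-- The sign relating `z j` to `z k` if they have the same absolute value: `1` if `z j = z k`, `-1` if
`z j = -z k`. It is `0` if the absolute values differ, and also if both entries vanish, so that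
`fun j => levelSign z j k` is an odd function of `z`. -/
noncomputable def levelSign {n : ℕ} (z : Fin n → ℝ) (j k : Fin n) : ℝ :=
  (if z j = z k then 1 else 0) - (if z j = -z k then 1 else 0)

/-- The number of indices `j` with `|z j| = |z k|` if `z k ≠ 0`, and `0` if `z k = 0`. -/
noncomputable def levelSize {n : ℕ} (z : Fin n → ℝ) (k : Fin n) : ℝ :=
  ∑ j, levelSign z j k ^ 2

/-- The mean of the signs relating the entries of the level of `z k` to `z k`; it is `0` if `z k = 0`,
by division by zero. As a vector in `k` it is the orthogonal projection of the all-ones vector to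
the odd functions of `z`. -/
noncomputable def levelMean {n : ℕ} (z : Fin n → ℝ) (k : Fin n) : ℝ :=
  (∑ j, levelSign z j k) / levelSize z k

section levelSign

variable {n : ℕ} (z : Fin n → ℝ)

theorem levelSign_comm (j k : Fin n) : levelSign z j k = levelSign z k j := by
  simp only [levelSign, eq_comm (a := z j), neg_eq_iff_eq_neg]

theorem levelSign_add_eq_zero {k l : Fin n} (h : z k + z l = 0) (j : Fin n) :
    levelSign z j k + levelSign z j l = 0 := by
  have h' : z k = -z l := by linarith
  simp only [levelSign, h', neg_neg]
  ring

theorem levelSign_congr {k l : Fin n} (h : z k = z l) (j : Fin n) :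
    levelSign z j k = levelSign z j l := by
  simp only [levelSign, h]

theorem levelSign_cases (j k : Fin n) :
    levelSign z j k = 0 ∨ (levelSign z j k = 1 ∧ z j = z k) ∨
      (levelSign z j k = -1 ∧ z j + z k = 0) := by
  by_cases h1 : z j = z k <;> by_cases h2 : z j = -z k
  · left; rw [levelSign, if_pos h1, if_pos h2, sub_self]
  · right; left; exact ⟨by rw [levelSign, if_pos h1, if_neg h2, sub_zero], h1⟩
  · right; right; exact ⟨by rw [levelSign, if_neg h1, if_pos h2, zero_sub], by linarith⟩
  · left; rw [levelSign, if_neg h1, if_neg h2, sub_self]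

theorem levelSign_self {k : Fin n} (h : z k ≠ 0) : levelSign z k k = 1 := by
  rw [levelSign, if_pos rfl, if_neg fun h' => h (by linarith), sub_zero]

theorem abs_levelSign (j k : Fin n) : |levelSign z j k| = levelSign z j k ^ 2 := by
  rcases levelSign_cases z j k with h | ⟨h, -⟩ | ⟨h, -⟩ <;> norm_num [h]

theorem levelSign_sq_le_one (j k : Fin n) : levelSign z j k ^ 2 ≤ 1 := by
  rcases levelSign_cases z j k with h | ⟨h, -⟩ | ⟨h, -⟩ <;> norm_num [h]

theorem levelSize_nonneg (k : Fin n) : 0 ≤ levelSize z k :=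
  Finset.sum_nonneg fun _ _ => sq_nonneg _

theorem one_le_levelSize {k : Fin n} (h : z k ≠ 0) : 1 ≤ levelSize z k := by
  have := Finset.single_le_sum (f := fun j => levelSign z j k ^ 2) (fun _ _ => sq_nonneg _)
    (Finset.mem_univ k)
  rw [levelSign_self z h, one_pow] at this
  exact this

theorem levelSize_eq_of_add_eq_zero {k l : Fin n} (h : z k + z l = 0) :
    levelSize z k = levelSize z l := by
  refine Finset.sum_congr rfl fun j _ => ?_
  rw [eq_neg_of_add_eq_zero_left (levelSign_add_eq_zero z h j), neg_sq]

theorem levelSize_congr {k l : Fin n} (h : z k = z l) : levelSize z k = levelSize z l := by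
  simp only [levelSize, levelSign_congr z h]

theorem levelMean_add_eq_zero {k l : Fin n} (h : z k + z l = 0) :
    levelMean z k + levelMean z l = 0 := by
  rw [levelMean, levelMean, levelSize_eq_of_add_eq_zero z h, ← add_div,
    ← Finset.sum_add_distrib]
  simp only [levelSign_add_eq_zero z h, Finset.sum_const_zero, zero_div]

theorem levelMean_congr {k l : Fin n} (h : z k = z l) : levelMean z k = levelMean z l := by
  simp only [levelMean, levelSize_congr z h, levelSign_congr z h]

theorem levelMean_mul_levelSign (j k : Fin n) :
    levelMean z j * levelSign z j k = levelMean z k * levelSign z j k ^ 2 := by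
  rcases levelSign_cases z j k with h | ⟨h, h'⟩ | ⟨h, h'⟩
  · simp [h]
  · rw [h, levelMean_congr z h']; ring
  · rw [h, eq_neg_of_add_eq_zero_left (levelMean_add_eq_zero z h')]; ring

theorem mul_levelSign (j k : Fin n) : z j * levelSign z j k = z k * levelSign z j k ^ 2 := by
  rcases levelSign_cases z j k with h | ⟨h, h'⟩ | ⟨h, h'⟩
  · simp [h]
  · rw [h, h']; ring
  · rw [h, eq_neg_of_add_eq_zero_left h']; ring

theorem levelSign_mul_div_levelSize (j k : Fin n) :
    levelSign z j k / levelSize z k = levelSign z j k / levelSize z j := by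
  rcases levelSign_cases z j k with h | ⟨-, h'⟩ | ⟨-, h'⟩
  · simp [h]
  · rw [levelSize_congr z h']
  · rw [levelSize_eq_of_add_eq_zero z h']

theorem levelSize_mul_levelMean (k : Fin n) :
    levelSize z k * levelMean z k = ∑ j, levelSign z j k := by
  by_cases h : levelSize z k = 0
  · have h0 := (Finset.sum_eq_zero_iff_of_nonneg fun j _ => sq_nonneg (levelSign z j k)).mp h
    rw [h, zero_mul]
    exact (Finset.sum_eq_zero fun j hj => by simpa using h0 j hj).symm
  · rw [levelMean, mul_div_cancel₀ _ h]

theorem abs_levelMean_le_one (k : Fin n) : |levelMean z k| ≤ 1 := by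
  rw [levelMean, abs_div, abs_of_nonneg (levelSize_nonneg z k)]
  refine div_le_one_of_le₀ ((Finset.abs_sum_le_sum_abs _ _).trans_eq ?_) (levelSize_nonneg z k)
  exact Finset.sum_congr rfl fun j _ => abs_levelSign z j k

/-- For an odd function `f` of `z`, the scalar products of `f` with `levelMean z` and with the all-ones
vector agree. The hypotheses express oddness: `f` changes sign along with `z` within a level and
vanishes where `z` does. -/
theorem sum_mul_levelMean_of {f : Fin n → ℝ}
    (hf : ∀ j k, f j * levelSign z j k = f k * levelSign z j k ^ 2)
    (hf0 : ∀ k, levelSize z k = 0 → f k = 0) :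
    ∑ k, f k * levelMean z k = ∑ k, f k := by
  have h : ∀ k, f k * levelMean z k = ∑ j, f j * (levelSign z k j ^ 2 / levelSize z j) := by
    intro k
    rw [levelMean, Finset.sum_div, Finset.mul_sum]
    refine Finset.sum_congr rfl fun j _ => ?_
    rw [levelSign_mul_div_levelSize, levelSign_comm z j k, ← mul_div_assoc, hf k j,
      mul_div_assoc]
  simp only [h]
  rw [Finset.sum_comm]
  refine Finset.sum_congr rfl fun j _ => ?_
  rw [← Finset.mul_sum, ← Finset.sum_div]
  by_cases hj : levelSize z j = 0
  · rw [hf0 j hj, zero_mul]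
  · rw [show ∑ k, levelSign z k j ^ 2 = levelSize z j from rfl, div_self hj, mul_one]

theorem sum_mul_levelMean : ∑ k, z k * levelMean z k = ∑ k, z k :=
  sum_mul_levelMean_of z (mul_levelSign z) fun k hk => by
    by_contra h
    linarith [one_le_levelSize z h]

theorem sum_levelMean_sq : ∑ k, levelMean z k ^ 2 = ∑ k, levelMean z k := by
  simp only [sq]
  exact sum_mul_levelMean_of z (levelMean_mul_levelSign z) fun k hk => by
    rw [levelMean, hk, div_zero]

/-- The product of size and mean is an integer `w`, and `|w| ≤ w ^ 2`. -/
theorem abs_levelMean_le (k : Fin n) :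
    |levelMean z k| ≤ levelSize z k * levelMean z k ^ 2 := by
  obtain ⟨w, hw⟩ : ∃ w : ℤ, ∑ j, levelSign z j k = w := by
    refine ⟨∑ j, ((if z j = z k then 1 else 0) - (if z j = -z k then 1 else 0)), ?_⟩
    push_cast
    rfl
  have h1 : |levelSize z k * levelMean z k| ≤ (levelSize z k * levelMean z k) ^ 2 := by
    rw [levelSize_mul_levelMean, hw]
    have h : |w| ≤ w ^ 2 := by
      rcases eq_or_ne w 0 with rfl | h0
      · simp
      · nlinarith [Int.one_le_abs h0, sq_abs w]
    exact_mod_cast h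
  by_cases h : levelSize z k = 0
  · simp [levelMean, h]
  have hpos := (levelSize_nonneg z k).lt_of_ne' h
  rw [abs_mul, abs_of_pos hpos] at h1
  refine le_of_mul_le_mul_left ?_ hpos
  linarith

end levelSign

/-! ### Stationary points -/

/-- In the application `N = n - 2`, `v = z i`, `Z = ∑ z k`, `a` and `s` are the mean and the size of the
level of `z i`, `W` and `T` are the sums of the squares and of the absolute values of the means off
that level, and `X`, `Q` come from the sign vector on and off that level. Equality holds for `X = 1`,
`a = s = 1`, `T = W = N + 1`, `Q = -T`. -/
theorem extremal_inequality {N a s T W X Q Z v : ℝ} (hN : 1 ≤ N) (ha : |a| ≤ 1)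
    (has : s * a ^ 2 ≥ |a|) (hT : T ≤ N + 1) (hTW : T ^ 2 ≤ (N + 1) * W)
    (hX : X ≤ 1) (hQ : |Q| ≤ T) (h1 : N * v + Z * a = X)
    (h2 : Z * (N + s * a ^ 2 + W) = a * s * X + Q) :
    v ≤ (3 * N + 2) / (2 * N * (N + 1)) := by
  have hM : 0 < N + 1 := by linarith
  have hW : 0 ≤ W := nonneg_of_mul_nonneg_right ((sq_nonneg T).trans hTW) hM
  have ha0 := abs_nonneg a
  have hD : 0 < N + s * a ^ 2 + W := by linarith
  have haQ : -(a * Q) ≤ |a| * T := by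
    refine (neg_le_abs _).trans ?_
    rw [abs_mul]
    exact mul_le_mul_of_nonneg_left hQ ha0
  have h3 : N * v * (N + s * a ^ 2 + W) = X * (N + W) - a * Q := by
    linear_combination (N + s * a ^ 2 + W) * h1 - a * h2
  have h4 : X * (N + W) ≤ N + W := mul_le_of_le_one_left (by linarith) hX
  -- the case `|a| = 1`, where `T = N + 1` is extremal
  have h5 : 2 * (N + 1) ^ 2 * (T - 1) ≤ N * ((N + 1) ^ 2 + T ^ 2) := by
    nlinarith [mul_nonneg hM.le (sub_nonneg.mpr hT), mul_nonneg (by linarith : 0 ≤ N)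
      (sq_nonneg (N + 1 - T))]
  -- the general case is affine in `|a|`, and trivial for `|a| = 0`
  have h6 : 2 * (N + 1) ^ 2 * (|a| * T - |a|) ≤ N * ((N + 1) * (N + |a|) + T ^ 2) := by
    nlinarith [mul_le_mul_of_nonneg_left h5 ha0, mul_nonneg (sub_nonneg.mpr ha)
      (by positivity : 0 ≤ N * ((N + 1) * N + T ^ 2))]
  have h7 : N * ((N + 1) * (N + |a|) + T ^ 2) ≤ (N + 1) * (N * (N + |a| + W)) := by
    nlinarith [mul_le_mul_of_nonneg_left hTW (by linarith : 0 ≤ N)]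
  have h8 : 2 * (N + 1) * (|a| * T - |a|) ≤ N * (N + |a| + W) :=
    le_of_mul_le_mul_left (by linarith) hM
  have h9 : 2 * (N + 1) * (|a| * T - s * a ^ 2) ≤ N * (N + s * a ^ 2 + W) := by
    nlinarith
  rw [le_div_iff₀ (by positivity)]
  refine le_of_mul_le_mul_right ?_ hD
  nlinarith

/-- The right side is the maximal absolute row sum of `((n - 2) I + 1 1ᵀ)⁻¹`. -/
theorem le_of_stationary {n : ℕ} (z : Fin n → ℝ) (hn : 3 ≤ n) {σ : Fin n → ℝ}
    (hσ : ∀ k, |σ k| ≤ 1)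
    (h : ∀ u : Fin n → ℝ, (∀ j k, z j + z k = 0 → u j + u k = 0) →
      ((n : ℝ) - 2) * ∑ k, z k * u k + (∑ k, z k) * ∑ k, u k = ∑ k, σ k * u k) (i : Fin n) :
    z i ≤ (3 * (n : ℝ) - 4) / (2 * ((n : ℝ) - 2) * ((n : ℝ) - 1)) := by
  have hn' : (3 : ℝ) ≤ n := by exact_mod_cast hn
  by_cases hi : z i = 0
  · rw [hi]
    exact div_nonneg (by linarith) (mul_nonneg (by linarith) (by linarith))
  have hs := one_le_levelSize z hi
  have hs0 : 0 < levelSize z i := by linarith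
  set s := levelSize z i with hs_def
  set a := levelMean z i with ha_def
  have hb := h (fun k => levelSign z k i) fun j k hjk => by
    rw [levelSign_comm z j, levelSign_comm z k]
    exact levelSign_add_eq_zero z hjk i
  have he := h (levelMean z) fun j k => levelMean_add_eq_zero z
  simp only [mul_levelSign, ← Finset.mul_sum] at hb
  rw [← levelSize_mul_levelMean, ← hs_def, ← ha_def,
    show ∑ k, levelSign z k i ^ 2 = s from rfl] at hb
  rw [sum_mul_levelMean, ← sum_levelMean_sq] at he
  -- separate the level of `z i` from the other levels
  set W := ∑ k, (1 - levelSign z k i ^ 2) * levelMean z k ^ 2 with hW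
  set T := ∑ k, (1 - levelSign z k i ^ 2) * |levelMean z k| with hT
  set Q := ∑ k, (1 - levelSign z k i ^ 2) * (σ k * levelMean z k) with hQ
  have hr : ∀ k, 0 ≤ 1 - levelSign z k i ^ 2 := fun k =>
    sub_nonneg.mpr (levelSign_sq_le_one z k i)
  have hE : ∑ k, levelMean z k ^ 2 = s * a ^ 2 + W := by
    rw [hs_def, levelSize, Finset.sum_mul, hW, ← Finset.sum_add_distrib]
    refine Finset.sum_congr rfl fun k _ => ?_
    have := levelMean_mul_levelSign z k i
    have h4 : levelSign z k i ^ 2 * levelSign z k i ^ 2 = levelSign z k i ^ 2 := by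
      rcases levelSign_cases z k i with h | ⟨h, -⟩ | ⟨h, -⟩ <;> norm_num [h]
    linear_combination (levelMean z k * levelSign z k i + a * levelSign z k i ^ 2) * this
      + a ^ 2 * h4
  have hσe : ∑ k, σ k * levelMean z k = a * ∑ k, σ k * levelSign z k i + Q := by
    rw [Finset.mul_sum, hQ, ← Finset.sum_add_distrib]
    refine Finset.sum_congr rfl fun k _ => ?_
    have := levelMean_mul_levelSign z k i
    have h3 : levelSign z k i ^ 2 * levelSign z k i = levelSign z k i := by
      rcases levelSign_cases z k i with h | ⟨h, -⟩ | ⟨h, -⟩ <;> norm_num [h]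
    linear_combination σ k * levelSign z k i * this + a * σ k * h3
  have hcard : ∑ k, (1 - levelSign z k i ^ 2) = n - s := by
    rw [Finset.sum_sub_distrib, hs_def, levelSize]
    simp
  have hT0 : 0 ≤ T := Finset.sum_nonneg fun k _ => mul_nonneg (hr k) (abs_nonneg _)
  have hTn : T ≤ ((n : ℝ) - 2) + 1 := by
    have : T ≤ ∑ k, (1 - levelSign z k i ^ 2) := Finset.sum_le_sum fun k _ =>
      mul_le_of_le_one_right (hr k) (abs_levelMean_le_one z k)
    linarith
  have hW0 : 0 ≤ W := Finset.sum_nonneg fun k _ => mul_nonneg (hr k) (sq_nonneg _)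
  have hTW : T ^ 2 ≤ (((n : ℝ) - 2) + 1) * W := by
    have hCS : T ^ 2 ≤ (∑ k, (1 - levelSign z k i ^ 2)) * W :=
      Finset.sum_sq_le_sum_mul_sum_of_sq_le_mul _ (fun k _ => hr k)
        (fun k _ => mul_nonneg (hr k) (sq_nonneg _)) fun k _ => by
          rw [mul_pow, sq_abs]; linarith
    nlinarith
  have hX : (∑ k, σ k * levelSign z k i) / s ≤ 1 := by
    refine div_le_one_of_le₀ (Finset.sum_le_sum fun k _ => ?_) hs0.le
    rw [← abs_levelSign]
    refine (le_abs_self _).trans ?_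
    rw [abs_mul]
    exact mul_le_of_le_one_left (abs_nonneg _) (hσ k)
  have hQT : |Q| ≤ T := by
    refine (Finset.abs_sum_le_sum_abs _ _).trans (Finset.sum_le_sum fun k _ => ?_)
    rw [abs_mul, abs_of_nonneg (hr k), abs_mul]
    exact mul_le_mul_of_nonneg_left (mul_le_of_le_one_left (abs_nonneg _) (hσ k)) (hr k)
  have := extremal_inequality (N := (n : ℝ) - 2) (Z := ∑ k, z k) (v := z i) (by linarith)
    (abs_levelMean_le_one z i) (abs_levelMean_le z i) hTn hTW hX hQT
    (by rw [eq_div_iff hs0.ne']; linear_combination hb)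
    (by
      rw [hE, hσe] at he
      rw [mul_assoc, mul_div_cancel₀ _ hs0.ne']
      linear_combination he)
  convert this using 2 <;> ring

/-! ### The norm of the inverse -/

/-- A column of `J⁻¹` has `ℓ¹` norm at most that of `(ℓ ((n - 2) I + 1 1ᵀ))⁻¹`. -/
theorem sum_abs_le_of_mulVec_eq_single {n : ℕ} (hn : 3 ≤ n) {ℓ : ℝ} (hℓ : 0 < ℓ)
    {J : Matrix (Fin n) (Fin n) ℝ} (hsymm : J.IsSymm)
    (hJ : ∀ i, J i i = ∑ j ∈ Finset.univ.erase i, J i j)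
    (hlower : ∀ i j, i ≠ j → ℓ ≤ J i j) {y : Fin n → ℝ} {i : Fin n}
    (hy : J *ᵥ y = Pi.single i 1) :
    ∑ k, |y k| ≤ (3 * (n : ℝ) - 4) / (2 * ℓ * ((n : ℝ) - 2) * ((n : ℝ) - 1)) := by
  have hn' : (3 : ℝ) ≤ n := by exact_mod_cast hn
  have hσ : ∀ k, |((SignType.sign (y k) : SignType) : ℝ)| ≤ 1 := fun k => by
    rcases lt_trichotomy (y k) 0 with h | h | h <;> simp [h]
  obtain ⟨z, hz, hvar⟩ := exists_variational_inequality (N := (n : ℝ) - 2) (by linarith) y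
    (fun k => ((SignType.sign (y k) : SignType) : ℝ)) hσ
  have hstat := le_of_stationary z hn hσ (fun u hu => by
    refine le_antisymm ?_ (hvar u (eventually_feasible hz hu))
    have := hvar (-u) (eventually_feasible hz fun j k hjk => by
      simp only [Pi.neg_apply]; linarith [hu j k hjk])
    simp only [Pi.neg_apply, mul_neg, Finset.sum_neg_distrib] at this
    linarith) i
  -- `z + t y` stays in the cone, as `(y j + y k) ^ 2 ≥ 0`
  have h1 := hvar y (by
    filter_upwards [self_mem_nhdsWithin] with t ht j k hjk
    have ht' : 0 ≤ t := le_of_lt ht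
    have := mul_nonneg ht' (mul_self_nonneg (y j + y k))
    linarith [hz j k hjk])
  simp only [sign_mul_self] at h1
  have h2 := le_sum_mul_mulVec_of_balanced hsymm hJ hlower hz
  rw [hy] at h2
  simp only [Pi.single_apply, mul_ite, mul_one, mul_zero, Finset.sum_ite_eq', Finset.mem_univ,
    if_true] at h2
  have h3 : ℓ * ∑ k, |y k| ≤ (3 * (n : ℝ) - 4) / (2 * ((n : ℝ) - 2) * ((n : ℝ) - 1)) :=
    (mul_le_mul_of_nonneg_left h1 hℓ.le).trans (h2.trans hstat)
  rw [mul_comm, ← le_div_iff₀ hℓ, div_div] at h3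
  refine h3.trans_eq ?_
  congr 1
  ring

/-! ### The norm of the adjugate -/

theorem mainTheorem5 (n : ℕ) (hn : 3 ≤ n) (ℓ m : ℝ) (hℓ : 0 < ℓ)
    (J : Matrix (Fin n) (Fin n) ℝ) (hsymm : J.IsSymm)
    (hlower : ∀ i j, i ≠ j → ℓ ≤ J i j) (hupper : ∀ i j, i ≠ j → J i j ≤ m)
    (hdiag : ∀ i, 0 < J i i) (hbal : IsDiagBalanced J) :
    ‖J.adjugate‖ / ∏ i, J i i ≤
      (3 * (n : ℝ) - 4) / (2 * ℓ * ((n : ℝ) - 2) * ((n : ℝ) - 1)) *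
        Real.exp (-ℓ ^ 2 / (4 * m ^ 2)) := by
  have hn' : (3 : ℝ) ≤ n := by exact_mod_cast hn
  have hJ : ∀ i, J i i = ∑ j ∈ Finset.univ.erase i, J i j := fun i => by
    have h := hbal i
    rw [diagDominance, abs_of_pos (hdiag i), sub_eq_zero] at h
    rw [h]
    exact Finset.sum_congr rfl fun j hj =>
      abs_of_pos (hℓ.trans_le (hlower i j (Finset.ne_of_mem_erase hj).symm))
  set c := (3 * (n : ℝ) - 4) / (2 * ℓ * ((n : ℝ) - 2) * ((n : ℝ) - 1)) with hc
  have hc0 : 0 ≤ c := div_nonneg (by linarith)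
    (mul_nonneg (mul_nonneg (by linarith) (by linarith)) (by linarith))
  have hdet : 0 < J.det := (posDef_of_balanced hn hsymm hJ hℓ hlower).det_pos
  have hadj : J.adjugate.IsSymm := by
    rw [Matrix.IsSymm, Matrix.adjugate_transpose, hsymm.eq]
  have hrow : ∀ i, ∑ j, |J.adjugate i j| ≤ J.det * c := by
    intro i
    have hy : J *ᵥ (fun j => J.adjugate i j / J.det) = Pi.single i 1 := by
      ext k
      have h := congrFun (congrFun (Matrix.mul_adjugate J) k) i
      simp only [Matrix.mulVec, dotProduct, ← mul_div_assoc, ← Finset.sum_div]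
      rw [div_eq_iff hdet.ne']
      simp only [← hadj.apply i]
      rw [Matrix.mul_apply] at h
      rw [h]
      simp [Matrix.one_apply, Pi.single_apply, mul_comm]
    have := sum_abs_le_of_mulVec_eq_single hn hℓ hsymm hJ hlower hy
    simp only [abs_div, abs_of_pos hdet, ← Finset.sum_div] at this
    rw [div_le_iff₀ hdet] at this
    linarith
  have hnorm : ‖J.adjugate‖ ≤ J.det * c := by
    rw [← Real.coe_toNNReal _ (mul_nonneg hdet.le hc0), Matrix.linfty_opNorm_def, NNReal.coe_le_coe]
    refine Finset.sup_le fun i _ => ?_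
    rw [← NNReal.coe_le_coe, Real.coe_toNNReal _ (mul_nonneg hdet.le hc0)]
    simpa using hrow i
  have hprod : 0 < ∏ i, J i i := Finset.prod_pos fun i _ => hdiag i
  calc ‖J.adjugate‖ / ∏ i, J i i ≤ J.det * c / ∏ i, J i i := by gcongr
    _ = c * (J.det / ∏ i, J i i) := by ring
    _ ≤ c * Real.exp (-ℓ ^ 2 / (4 * m ^ 2)) :=
      mul_le_mul_of_nonneg_left
        (det_div_prod_diag_le_exp hn hℓ hsymm hlower hupper hdiag hJ) hc0
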